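/- Let $f:[0,1]\to[0,1]$, $f(x)=2x \bmod 1$ (the fractional part of $2x$), be the doubling map, let $\mathrm{Leb}$ be Lebesgue measure on $[0,1]$, and for $n\in\mathbb N$, $r\ge 0$ and $x\in[0,1]$ put $$R_n(r,x)=\#\{\,j\in\{1,\dots,n\}:\ |x-f^j(x)|\le r\,\},$$ where $f^j$ is the $j$-th iterate of $f$. Then for every real $\tau>0$ and every integer $k\ge 0$, with $r_n=\frac{\tau}{2n}$, $$\lim_{n\to\infty}\mathrm{Leb}\bigl(\{x\in[0,1]:\ R_n(r_n,x)=k\}\bigr)=\frac{\tau^k}{k!}\,e^{-\tau}.$$ -/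

import Mathlib

/-- The recurrence counting function `R_n(r, x) = #{j ∈ [1, n] : d(x, f^j(x)) ≤ r}` of a
self-map `f` of a metric space. -/
noncomputable def recurrenceCount {X : Type*} [PseudoMetricSpace X] (f : X → X)
    (n : ℕ) (r : ℝ) (x : X) : ℕ :=
  open Classical in
  ((Finset.Icc 1 n).filter fun j : ℕ => dist x (f^[j] x) ≤ r).card

/-- The doubling map `x ↦ 2x mod 1` of the unit interval `[0, 1]`. -/
noncomputable def doublingMap (x : unitInterval) : unitInterval :=
  ⟨Int.fract (2 * (x : ℝ)), Int.fract_nonneg _, (Int.fract_lt_one _).le⟩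

/-!
Let `T x = b x mod 1` and write `x` in base `b`. Once the first `m + 1` digits of `x` are fixed, to
the index `w` of a cell of length `b ^ (-(m + 1))`, the remaining digits are those of `T^[m + 1] x`,
which is still uniformly distributed. Up to boundary effects at the cell scale, the return
`|x - T^[j] x| ≤ r` at a time `j > m` is the visit of `T^[j] x` to a union of about
`2 r b ^ (m + 1)` cells around the `w`-th one, so recurrence conditioned on `w` becomes a hitting
problem for a fixed target.

The target is decided by `m + 1` digits, hence visits to it more than `m` steps apart are
independent, and the number of visits is close to binomial as soon as short return times of the
target are negligible. This fails for individual `w` (near periodic points), but holds on average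
over `w`: a visit repeated after `g` steps forces `T^[g] x` to be close to `x`, whichever `w` is.
With `m = √n` the total error tends to `0`, and the binomial laws converge to the Poisson law.
-/

open Filter Function MeasureTheory Set Topology

section Counting

variable {α ι : Type*} [MeasurableSpace α] {μ : Measure α}

theorem measureReal_biUnion_finset_le_card_mul {s : Finset ι} {A : ι → Set α} {c : ℝ}
    (hA : ∀ i ∈ s, μ.real (A i) ≤ c) : μ.real (⋃ i ∈ s, A i) ≤ s.card * c :=
  nsmul_eq_mul s.card c ▸
    (measureReal_biUnion_finset_le s A).trans (Finset.sum_le_card_nsmul s _ c hA)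

variable [IsFiniteMeasure μ]

theorem abs_measureReal_sub_le_of_forall_notMem_iff {s t e : Set α} (h : ∀ x ∉ e, x ∈ s ↔ x ∈ t) :
    |μ.real s - μ.real t| ≤ μ.real e := by
  have le_add {u v : Set α} (huv : ∀ x ∉ e, x ∈ u → x ∈ v) :
      μ.real u ≤ μ.real v + μ.real e :=
    (measureReal_mono fun x hx => or_iff_not_imp_right.2 fun hxe => huv x hxe hx).trans
      (measureReal_union_le v e)
  rw [abs_sub_le_iff, sub_le_iff_le_add', sub_le_iff_le_add']
  exact ⟨add_comm (μ.real e) _ ▸ le_add fun x hx => (h x hx).1,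
    add_comm (μ.real e) _ ▸ le_add fun x hx => (h x hx).2⟩

theorem sum_measureReal_inter_le_mul {s : Finset ι} {A : ι → Set α} {E : Set α} {c : ℝ}
    (hA : ∀ i, MeasurableSet (A i)) (hE : MeasurableSet E)
    (hc : ∀ x, ∑ i ∈ s, (A i).indicator (1 : α → ℝ) x ≤ c) :
    ∑ i ∈ s, μ.real (A i ∩ E) ≤ c * μ.real E := by
  have integrable_indicator {S : Set α} (hS : MeasurableSet S) :
      Integrable (S.indicator (1 : α → ℝ)) μ :=
    (integrable_const 1).indicator hS
  calc ∑ i ∈ s, μ.real (A i ∩ E)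
      = ∫ x, ∑ i ∈ s, (A i ∩ E).indicator (1 : α → ℝ) x ∂μ := by
        rw [integral_finsetSum _ fun i _ => integrable_indicator ((hA i).inter hE)]
        exact Finset.sum_congr rfl fun i _ => (integral_indicator_one ((hA i).inter hE)).symm
    _ ≤ ∫ x, c * E.indicator 1 x ∂μ := by
        refine integral_mono
          (integrable_finsetSum _ fun i _ => integrable_indicator ((hA i).inter hE))
          ((integrable_indicator hE).const_mul c) fun x => ?_
        simp only [inter_indicator_one, Pi.mul_apply, ← Finset.sum_mul]
        exact mul_le_mul_of_nonneg_right (hc x) (indicator_nonneg (by simp) x)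
    _ = c * μ.real E := by rw [integral_const_mul, integral_indicator_one hE]

end Counting

section Binomial

/-- The probability that a binomial random variable with `n` trials and success probability `p`
takes the value `k`, for an arbitrary real `p`. -/
noncomputable def binomialWeight (p : ℝ) (n k : ℕ) : ℝ :=
  n.choose k * p ^ k * (1 - p) ^ (n - k)

theorem binomialWeight_succ_zero (p : ℝ) (n : ℕ) :
    binomialWeight p (n + 1) 0 = (1 - p) * binomialWeight p n 0 := by
  simp [binomialWeight, pow_succ']

theorem binomialWeight_succ_succ (p : ℝ) (n k : ℕ) :
    binomialWeight p (n + 1) (k + 1) =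
      (1 - p) * binomialWeight p n (k + 1) + p * binomialWeight p n k := by
  simp only [binomialWeight, Nat.choose_succ_succ' n k, Nat.add_sub_add_right]
  rcases lt_or_ge k n with h | h
  · rw [show n - k = n - (k + 1) + 1 by lia]
    push_cast
    ring
  · rw [Nat.choose_eq_zero_of_lt (show n < k + 1 by lia)]
    push_cast
    ring

open ProbabilityTheory in
theorem binomialWeight_mem_Icc {p : ℝ} (hp : p ∈ Icc (0 : ℝ) 1) (n k : ℕ) :
    binomialWeight p n k ∈ Icc (0 : ℝ) 1 := by
  have h : binomialWeight p n k = (binomial n ⟨p, hp⟩).real {k} :=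
    (binomial_real_singleton n k ⟨p, hp⟩).symm
  exact h ▸ ⟨measureReal_nonneg, measureReal_le_one⟩

end Binomial

section VisitCount

variable {α : Type*}

/-- The number of visits of the orbit of `x` under `f` to the set `B` at the times `0, …, n - 1`. -/
noncomputable def visitCount (f : α → α) (B : Set α) (n : ℕ) (x : α) : ℕ :=
  birkhoffSum f (B.indicator 1) n x

variable {f : α → α} {B : Set α} {m n : ℕ} {x : α}

open Classical in
theorem visitCount_iterate (f : α → α) (B : Set α) (n l : ℕ) (x : α) :
    visitCount f B n (f^[l] x) = ((Finset.Ico l (l + n)).filter fun j => f^[j] x ∈ B).card := by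
  simp only [visitCount, birkhoffSum, Finset.card_filter, Finset.sum_Ico_eq_sum_range,
    indicator_apply, ← iterate_add_apply, add_comm l, Nat.add_sub_cancel, Pi.one_apply]

theorem visitCount_eq_zero_iff : visitCount f B n x = 0 ↔ ∀ j < n, f^[j] x ∉ B := by
  simp [visitCount, birkhoffSum]

theorem visitCount_succ_of_mem (hx : x ∈ B) :
    visitCount f B (n + 1) x = visitCount f B n (f x) + 1 := by
  rw [visitCount, birkhoffSum_succ', indicator_of_mem hx, Pi.one_apply, add_comm, visitCount]

theorem visitCount_succ_of_notMem (hx : x ∉ B) :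
    visitCount f B (n + 1) x = visitCount f B n (f x) := by
  rw [visitCount, birkhoffSum_succ', indicator_of_notMem hx, zero_add, visitCount]

theorem visitCount_eq_visitCount_iterate (h : visitCount f B m x = 0) :
    visitCount f B n x = visitCount f B (n - m) (f^[m] x) := by
  rcases le_total m n with hmn | hnm
  · obtain ⟨l, rfl⟩ := Nat.exists_eq_add_of_le hmn
    rw [Nat.add_sub_cancel_left, visitCount, birkhoffSum_add, ← visitCount, h, zero_add, visitCount]
  · rw [visitCount_eq_zero_iff.2 fun j hj => visitCount_eq_zero_iff.1 h j (hj.trans_le hnm),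
      Nat.sub_eq_zero_of_le hnm, visitCount, birkhoffSum_zero]

variable [MeasurableSpace α]

theorem measurable_visitCount (hf : Measurable f) (hB : MeasurableSet B) (n : ℕ) :
    Measurable (visitCount f B n) := by
  unfold visitCount birkhoffSum
  exact Finset.measurable_sum _ fun k _ => (measurable_one.indicator hB).comp (hf.iterate k)

variable {μ : Measure α}

/-- The cost of replacing, after a visit to `B`, the next `m` steps by no visit at all: the
probability of a visit among them, unconditionally (first term) and jointly with the visit at
time `0` (second term). -/
noncomputable def clusterError (μ : Measure α) (f : α → α) (B : Set α) (m : ℕ) : ℝ :=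
  m * μ.real B ^ 2 + ∑ g ∈ Finset.range m, μ.real (B ∩ f^[g + 1] ⁻¹' B)

theorem abs_measureReal_inter_preimage_visitCount_sub_le [IsFiniteMeasure μ]
    (hf : MeasurePreserving f μ μ) (hB : MeasurableSet B)
    (hind : ∀ C, MeasurableSet C → μ.real (B ∩ f^[m + 1] ⁻¹' C) = μ.real B * μ.real C) (n k : ℕ) :
    |μ.real (B ∩ f ⁻¹' {x | visitCount f B n x = k}) -
      μ.real B * μ.real {x | visitCount f B n x = k}| ≤ clusterError μ f B m := by
  set V : ℕ → Set α := fun n => {x | visitCount f B n x = k}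
  have hV (n : ℕ) : MeasurableSet (V n) :=
    measurable_visitCount hf.measurable hB n (measurableSet_singleton k)
  set E : Set α := ⋃ g ∈ Finset.range m, f^[g + 1] ⁻¹' B
  have skip : ∀ x ∉ E, x ∈ f ⁻¹' V n ↔ x ∈ f^[m + 1] ⁻¹' V (n - m) := fun x hx => by
    have no_visit : visitCount f B m (f x) = 0 := by simpa [E, visitCount_eq_zero_iff] using hx
    simp only [V, mem_preimage, mem_ofPred_eq, visitCount_eq_visitCount_iterate no_visit,
      iterate_succ_apply]
  have real_E : μ.real E ≤ m * μ.real B := by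
    refine (measureReal_biUnion_finset_le_card_mul fun g _ => ?_).trans_eq
      (by rw [Finset.card_range])
    exact ((hf.iterate (g + 1)).measureReal_preimage hB.nullMeasurableSet).le
  have real_B_inter_E :
      μ.real (B ∩ E) ≤ ∑ g ∈ Finset.range m, μ.real (B ∩ f^[g + 1] ⁻¹' B) := by
    rw [inter_iUnion₂]
    exact measureReal_biUnion_finset_le _ _
  have joint : |μ.real (B ∩ f ⁻¹' V n) - μ.real B * μ.real (V (n - m))| ≤ μ.real (B ∩ E) := by
    rw [← hind _ (hV _)]
    exact abs_measureReal_sub_le_of_forall_notMem_iff fun x hx =>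
      and_congr_right fun hxB => skip x fun hxE => hx ⟨hxB, hxE⟩
  have marginal : |μ.real (V (n - m)) - μ.real (V n)| ≤ μ.real E := by
    rw [abs_sub_comm, ← hf.measureReal_preimage (hV n).nullMeasurableSet,
      ← (hf.iterate (m + 1)).measureReal_preimage (hV (n - m)).nullMeasurableSet]
    exact abs_measureReal_sub_le_of_forall_notMem_iff skip
  calc |μ.real (B ∩ f ⁻¹' V n) - μ.real B * μ.real (V n)|
      ≤ μ.real (B ∩ E) + |μ.real B * μ.real (V (n - m)) - μ.real B * μ.real (V n)| :=
        (abs_sub_le _ _ _).trans (add_le_add_left joint _)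
    _ = μ.real (B ∩ E) + μ.real B * |μ.real (V (n - m)) - μ.real (V n)| := by
        rw [← mul_sub, abs_mul, abs_of_nonneg measureReal_nonneg]
    _ ≤ (∑ g ∈ Finset.range m, μ.real (B ∩ f^[g + 1] ⁻¹' B)) + μ.real B * (m * μ.real B) := by
        gcongr
        exact marginal.trans real_E
    _ = clusterError μ f B m := by rw [clusterError]; ring

theorem measureReal_visitCount_succ_eq_zero [IsFiniteMeasure μ]
    (hf : MeasurePreserving f μ μ) (hB : MeasurableSet B) (n : ℕ) :
    μ.real {x | visitCount f B (n + 1) x = 0} = μ.real {x | visitCount f B n x = 0} -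
      μ.real (B ∩ f ⁻¹' {x | visitCount f B n x = 0}) := by
  set V : Set α := {x | visitCount f B n x = 0}
  have hV : MeasurableSet V := measurable_visitCount hf.measurable hB n (measurableSet_singleton 0)
  have first_step : {x | visitCount f B (n + 1) x = 0} = f ⁻¹' V \ B := by
    ext x
    by_cases hx : x ∈ B
    · simp [hx, visitCount_succ_of_mem hx]
    · simp [V, hx, visitCount_succ_of_notMem hx]
  rw [first_step, ← hf.measureReal_preimage hV.nullMeasurableSet, inter_comm, eq_sub_iff_add_eq,
    add_comm, measureReal_inter_add_sdiff hB]

theorem measureReal_visitCount_succ_eq_succ [IsFiniteMeasure μ]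
    (hf : MeasurePreserving f μ μ) (hB : MeasurableSet B) (n k : ℕ) :
    μ.real {x | visitCount f B (n + 1) x = k + 1} =
      μ.real {x | visitCount f B n x = k + 1} -
        μ.real (B ∩ f ⁻¹' {x | visitCount f B n x = k + 1}) +
      μ.real (B ∩ f ⁻¹' {x | visitCount f B n x = k}) := by
  set V : ℕ → Set α := fun i => {x | visitCount f B n x = i}
  have hV (i : ℕ) : MeasurableSet (V i) :=
    measurable_visitCount hf.measurable hB n (measurableSet_singleton i)
  have first_step : {x | visitCount f B (n + 1) x = k + 1} =
      (f ⁻¹' V (k + 1) \ B) ∪ (B ∩ f ⁻¹' V k) := by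
    ext x
    by_cases hx : x ∈ B
    · simp [V, hx, visitCount_succ_of_mem hx]
    · simp [V, hx, visitCount_succ_of_notMem hx]
  rw [first_step, measureReal_union (disjoint_sdiff_left.mono_right inter_subset_left)
      (hB.inter (hf.measurable (hV k))), add_left_inj,
    ← hf.measureReal_preimage (hV (k + 1)).nullMeasurableSet, inter_comm, eq_sub_iff_add_eq,
    add_comm, measureReal_inter_add_sdiff hB]

theorem abs_measureReal_visitCount_sub_binomialWeight_le [IsProbabilityMeasure μ]
    (hf : MeasurePreserving f μ μ) (hB : MeasurableSet B)
    (hind : ∀ C, MeasurableSet C → μ.real (B ∩ f^[m + 1] ⁻¹' C) = μ.real B * μ.real C) (n k : ℕ) :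
    |μ.real {x | visitCount f B n x = k} - binomialWeight (μ.real B) n k| ≤
      n * (2 * clusterError μ f B m) := by
  have hp0 : 0 ≤ μ.real B := measureReal_nonneg
  have hp1 : μ.real B ≤ 1 := measureReal_le_one
  induction n generalizing k with
  | zero => cases k <;> simp [visitCount, binomialWeight]
  | succ n ih =>
    have decoupling := abs_measureReal_inter_preimage_visitCount_sub_le hf hB hind n
    push_cast
    -- The binomial recursion is a convex combination, so the decoupling errors merely add up.
    cases k with
    | zero =>
      rw [measureReal_visitCount_succ_eq_zero hf hB, binomialWeight_succ_zero]
      have h₀ := abs_le.1 (ih 0)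
      have d₀ := abs_le.1 (decoupling 0)
      rw [abs_le]
      constructor <;> nlinarith
    | succ k =>
      rw [measureReal_visitCount_succ_eq_succ hf hB, binomialWeight_succ_succ]
      have h₀ := abs_le.1 (ih k)
      have h₁ := abs_le.1 (ih (k + 1))
      have d₀ := abs_le.1 (decoupling k)
      have d₁ := abs_le.1 (decoupling (k + 1))
      rw [abs_le]
      constructor <;> nlinarith

end VisitCount

section TimesMap

/-- Lebesgue measure on the unit interval, as a probability measure on `ℝ`. -/
noncomputable def unitMeasure : Measure ℝ := volume.restrict (Ico 0 1)

instance : IsProbabilityMeasure unitMeasure :=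
  ⟨by simp [unitMeasure]⟩

/-- Multiplication by `b` modulo `1`, as a map of `ℝ`. -/
noncomputable def timesMap (b : ℕ) (x : ℝ) : ℝ := Int.fract (b * x)

variable {M : ℕ}

theorem measurable_timesMap (b : ℕ) : Measurable (timesMap b) :=
  (measurable_const_mul (b : ℝ)).fract

theorem timesMap_timesMap (a b : ℕ) (x : ℝ) : timesMap a (timesMap b x) = timesMap (a * b) x := by
  have h : (a : ℝ) * Int.fract (b * x) = (a * b : ℕ) * x - (a * ⌊b * x⌋ : ℤ) := by
    rw [Int.fract]
    push_cast
    ring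
  rw [timesMap, timesMap, h, Int.fract_sub_intCast, timesMap]

theorem iterate_timesMap (b : ℕ) {j : ℕ} (hj : j ≠ 0) : (timesMap b)^[j] = timesMap (b ^ j) := by
  induction j, Nat.one_le_iff_ne_zero.2 hj using Nat.le_induction with
  | base => simp
  | succ j hle ih =>
    ext x
    rw [iterate_succ_apply', ih (Nat.ne_of_gt hle), timesMap_timesMap, ← pow_succ']

theorem floor_mul_mem_Ico {x : ℝ} (hM : 0 < M) (hx : x ∈ Ico (0 : ℝ) 1) :
    ⌊M * x⌋ ∈ Finset.Ico 0 (M : ℤ) := by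
  have hM' : (0 : ℝ) < M := by exact_mod_cast hM
  rw [Finset.mem_Ico, Int.le_floor, Int.floor_lt]
  constructor
  · simpa using mul_nonneg hM'.le hx.1
  · simpa using mul_lt_of_lt_one_right hM' hx.2

theorem unitMeasure_real_floor_eq_and_timesMap_mem {w : ℤ} (hw : w ∈ Finset.Ico 0 (M : ℤ))
    (S : Set ℝ) : unitMeasure.real {x | ⌊M * x⌋ = w ∧ timesMap M x ∈ S} =
      unitMeasure.real S / M := by
  obtain ⟨hw0, hwM⟩ := Finset.mem_Ico.1 hw
  have hM : (0 : ℝ) < M := by exact_mod_cast hw0.trans_lt hwM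
  have branch : {x : ℝ | ⌊M * x⌋ = w ∧ timesMap M x ∈ S} ∩ Ico 0 1 =
      (M * · : ℝ → ℝ) ⁻¹' ((· - (w : ℝ)) ⁻¹' (S ∩ Ico 0 1)) := by
    ext x
    have hw0' : (0 : ℝ) ≤ w := by exact_mod_cast hw0
    have hwM' : (w : ℝ) + 1 ≤ M := by exact_mod_cast hwM
    simp only [mem_inter_iff, mem_ofPred_eq, mem_preimage, mem_Ico, sub_nonneg,
      sub_lt_iff_lt_add', timesMap, Int.fract]
    constructor
    · rintro ⟨⟨rfl, hS⟩, -⟩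
      exact ⟨hS, Int.floor_le _, Int.lt_floor_add_one _⟩
    · rintro ⟨hS, hx⟩
      have hfloor : ⌊M * x⌋ = w := Int.floor_eq_iff.2 hx
      refine ⟨⟨hfloor, hfloor ▸ hS⟩, ?_, ?_⟩ <;> nlinarith
  rw [unitMeasure, measureReal_restrict_apply' measurableSet_Ico, branch,
    measureReal_restrict_apply' measurableSet_Ico, measureReal_def,
    Real.volume_preimage_mul_left hM.ne', ENNReal.toReal_mul,
    ENNReal.toReal_ofReal (abs_nonneg _), abs_of_pos (inv_pos.2 hM), inv_mul_eq_div]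
  simp only [sub_eq_add_neg, measure_preimage_add_right, ← measureReal_def]

theorem unitMeasure_real_timesMap_mem_floor (hM : 0 < M) {Q : ℤ → Set ℝ}
    (hQ : ∀ w, MeasurableSet (Q w)) : unitMeasure.real {x | timesMap M x ∈ Q ⌊M * x⌋} =
      (∑ w ∈ Finset.Ico 0 (M : ℤ), unitMeasure.real (Q w)) / M := by
  have hcell (w : ℤ) : MeasurableSet {x : ℝ | ⌊M * x⌋ = w ∧ timesMap M x ∈ Q w} :=
    ((Int.measurable_floor.comp (measurable_const_mul _)) (measurableSet_singleton w)).inter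
      (measurable_timesMap M (hQ w))
  have hunion : {x : ℝ | timesMap M x ∈ Q ⌊M * x⌋} ∩ Ico 0 1 =
      (⋃ w ∈ Finset.Ico 0 (M : ℤ), {x : ℝ | ⌊M * x⌋ = w ∧ timesMap M x ∈ Q w}) ∩ Ico 0 1 := by
    ext x
    simp only [mem_inter_iff, mem_ofPred_eq, mem_iUnion, exists_prop, and_congr_left_iff]
    intro hx
    have := floor_mul_mem_Ico hM hx
    aesop
  have hdisj : (↑(Finset.Ico 0 (M : ℤ)) : Set ℤ).PairwiseDisjoint
      fun w => {x : ℝ | ⌊M * x⌋ = w ∧ timesMap M x ∈ Q w} :=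
    fun v _ w _ hvw => disjoint_left.2 fun x hv hw => hvw (hv.1.symm.trans hw.1)
  have restrict_inter (S : Set ℝ) : unitMeasure.real (S ∩ Ico 0 1) = unitMeasure.real S := by
    simp [unitMeasure, measureReal_restrict_apply', inter_assoc]
  rw [← restrict_inter, hunion, restrict_inter,
    measureReal_biUnion_finset hdisj fun w _ => hcell w, Finset.sum_div]
  exact Finset.sum_congr rfl fun w hw => unitMeasure_real_floor_eq_and_timesMap_mem hw (Q w)

theorem measurePreserving_timesMap (hM : 0 < M) :
    MeasurePreserving (timesMap M) unitMeasure unitMeasure := by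
  refine ⟨measurable_timesMap M, Measure.ext fun S hS => ?_⟩
  have : (M : ℝ) ≠ 0 := by positivity
  rw [Measure.map_apply (measurable_timesMap M) hS, ← measureReal_eq_measureReal_iff]
  have h := unitMeasure_real_timesMap_mem_floor hM fun _ => hS
  rwa [Finset.sum_const, Int.card_Ico, sub_zero, Int.toNat_natCast, nsmul_eq_mul,
    mul_div_cancel_left₀ _ this] at h

theorem unitMeasure_real_floor_mem (hM : 0 < M) (W : Finset ℤ) (hW : W ⊆ Finset.Ico 0 (M : ℤ)) :
    unitMeasure.real {x | ⌊M * x⌋ ∈ W} = W.card / M := by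
  classical
  have h := unitMeasure_real_timesMap_mem_floor hM (Q := fun w => {_x | w ∈ W})
    fun w => MeasurableSet.const _
  have hcell (w : ℤ) : unitMeasure.real {_x : ℝ | w ∈ W} = if w ∈ W then 1 else 0 := by
    split_ifs with hw <;> simp [hw]
  simp only [mem_ofPred_eq, hcell, Finset.sum_boole, Finset.filter_mem_eq_inter,
    Finset.inter_eq_right.2 hW] at h
  exact h

theorem unitMeasure_real_floor_mem_inter (hM : 0 < M) (W : Set ℤ) {S : Set ℝ}
    (hS : MeasurableSet S) :
    unitMeasure.real ({x | ⌊M * x⌋ ∈ W} ∩ timesMap M ⁻¹' S) =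
      unitMeasure.real {x | ⌊M * x⌋ ∈ W} * unitMeasure.real S := by
  classical
  have hcell (S : Set ℝ) (w : ℤ) :
      unitMeasure.real {x | w ∈ W ∧ x ∈ S} = (if w ∈ W then 1 else 0) * unitMeasure.real S := by
    split_ifs with hw <;> simp [hw]
  have hjoint {S : Set ℝ} (hS : MeasurableSet S) :
      unitMeasure.real ({x | ⌊M * x⌋ ∈ W} ∩ timesMap M ⁻¹' S) =
        (∑ w ∈ Finset.Ico 0 (M : ℤ), if w ∈ W then 1 else 0) / M * unitMeasure.real S := by
    have h := unitMeasure_real_timesMap_mem_floor hM (Q := fun w => {x | w ∈ W ∧ x ∈ S})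
      fun w => (MeasurableSet.const _).inter hS
    simp only [hcell, ← Finset.sum_mul] at h
    rw [div_mul_eq_mul_div]
    exact h
  have hmarginal := hjoint MeasurableSet.univ
  rw [preimage_univ, inter_univ, probReal_univ, mul_one] at hmarginal
  rw [hjoint hS, hmarginal]

end TimesMap

section Return

variable {M : ℕ} {ε : ℝ}

theorem unitMeasure_real_abs_sub_timesMap_sub_le (hM : 2 ≤ M) (hε : 0 ≤ ε) (c : ℝ) :
    unitMeasure.real {x | |x - timesMap M x - c| ≤ ε} ≤ 4 * ε := by
  have hM' : (2 : ℝ) ≤ M := by exact_mod_cast hM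
  have hM0 : (0 : ℝ) < M := by linarith
  set Q : ℤ → Set ℝ := fun w => {y | |(w + y) / M - y - c| ≤ ε}
  have hQ (w : ℤ) : MeasurableSet (Q w) :=
    measurableSet_le (by fun_prop) measurable_const
  have inverse_branch (x : ℝ) : x = (⌊M * x⌋ + timesMap M x) / M := by
    rw [timesMap, Int.floor_add_fract]
    field_simp
  have hset : {x | |x - timesMap M x - c| ≤ ε} = {x : ℝ | timesMap M x ∈ Q ⌊M * x⌋} :=
    ext fun x => by simp only [Q, mem_ofPred_eq, ← inverse_branch x]
  -- On each branch the displacement is affine of slope `-(1 - 1 / M)`.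
  have slice (w : ℤ) : Q w ⊆ Metric.closedBall ((w / M - c) / (1 - 1 / M)) (2 * ε) := by
    intro y hy
    have hslope : 1 / 2 ≤ 1 - 1 / (M : ℝ) := by
      linarith [one_div_le_one_div_of_le two_pos hM']
    have hfactor : (w + y) / M - y - c =
        -((1 - 1 / M) * (y - (w / M - c) / (1 - 1 / M))) := by
      rw [mul_sub, mul_div_cancel₀ _ (by linarith)]
      ring
    rw [mem_ofPred_eq, hfactor, abs_neg, abs_mul, abs_of_pos (by linarith)] at hy
    rw [Metric.mem_closedBall, Real.dist_eq]
    nlinarith [abs_nonneg (y - (w / M - c) / (1 - 1 / M))]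
  have real_Q (w : ℤ) : unitMeasure.real (Q w) ≤ 4 * ε :=
    calc unitMeasure.real (Q w)
        ≤ volume.real (Metric.closedBall ((w / M - c) / (1 - 1 / M)) (2 * ε)) :=
          (measureReal_mono (slice w)).trans
            (ENNReal.toReal_mono measure_closedBall_lt_top.ne (Measure.restrict_apply_le _ _))
      _ = 4 * ε := by rw [Real.volume_real_closedBall (by linarith)]; ring
  rw [hset, unitMeasure_real_timesMap_mem_floor (by lia) hQ, div_le_iff₀' hM0]
  simpa using Finset.sum_le_card_nsmul (Finset.Ico 0 (M : ℤ)) _ _ fun w _ => real_Q w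

theorem unitMeasure_real_abs_sub_timesMap_le (hM : 2 ≤ M) (hε : 0 ≤ ε) :
    unitMeasure.real {x | |x - timesMap M x| ≤ ε} ≤ 4 * ε := by
  simpa using unitMeasure_real_abs_sub_timesMap_sub_le hM hε 0

theorem unitMeasure_real_abs_abs_sub_timesMap_sub_le (hM : 2 ≤ M) (hε : 0 ≤ ε) (r : ℝ) :
    unitMeasure.real {x | |(|x - timesMap M x| - r)| ≤ ε} ≤ 8 * ε :=
  calc unitMeasure.real {x | |(|x - timesMap M x| - r)| ≤ ε}
      ≤ unitMeasure.real ({x | |x - timesMap M x - r| ≤ ε} ∪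
          {x | |x - timesMap M x - -r| ≤ ε}) := by
        refine measureReal_mono fun x (hx : |(|x - timesMap M x| - r)| ≤ ε) => ?_
        rcases abs_choice (x - timesMap M x) with h | h <;> rw [h] at hx
        · exact Or.inl hx
        · exact Or.inr (by rwa [← abs_neg, neg_sub', neg_neg] : |x - timesMap M x - -r| ≤ ε)
    _ ≤ 4 * ε + 4 * ε := (measureReal_union_le _ _).trans
        (add_le_add (unitMeasure_real_abs_sub_timesMap_sub_le hM hε r)
          (unitMeasure_real_abs_sub_timesMap_sub_le hM hε (-r)))
    _ = 8 * ε := by ring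

end Return

section Cell

/-- The set of points lying at most `K` cells away from the `w`-th cell `[w / M, (w + 1) / M)` of
the subdivision of the line into intervals of length `1 / M`. -/
def cellNbhd (M K : ℕ) (w : ℤ) : Set ℝ := {y | ⌊M * y⌋ ∈ Finset.Icc (w - K) (w + K)}

variable {M K : ℕ} {w : ℤ} {x y r : ℝ}

theorem measurableSet_cellNbhd (M K : ℕ) (w : ℤ) : MeasurableSet (cellNbhd M K w) :=
  Int.measurable_floor.comp (measurable_const_mul (M : ℝ))
    (Finset.Icc (w - K) (w + K)).measurableSet

theorem unitMeasure_real_cellNbhd (hw : w ∈ Finset.Ico (K : ℤ) (M - K)) :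
    unitMeasure.real (cellNbhd M K w) = (2 * K + 1) / M := by
  rw [Finset.mem_Ico] at hw
  have hsub : Finset.Icc (w - K) (w + K) ⊆ Finset.Ico 0 (M : ℤ) := fun v hv => by
    rw [Finset.mem_Icc] at hv
    exact Finset.mem_Ico.2 (by lia)
  have hcard : (Finset.Icc (w - K) (w + K)).card = 2 * K + 1 := by
    rw [Int.card_Icc]
    lia
  rw [cellNbhd, unitMeasure_real_floor_mem (by lia) _ hsub, hcard]
  push_cast
  rfl

theorem mem_cellNbhd_floor_iff :
    y ∈ cellNbhd M K ⌊M * x⌋ ↔ |(⌊M * x⌋ - ⌊M * y⌋ : ℝ)| ≤ K := by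
  have h : |(⌊M * x⌋ - ⌊M * y⌋ : ℝ)| ≤ K ↔ |⌊M * x⌋ - ⌊M * y⌋| ≤ (K : ℤ) := by
    exact_mod_cast Iff.rfl
  rw [h, abs_le, cellNbhd, mem_ofPred_eq, Finset.mem_Icc]
  lia

theorem abs_floor_sub_floor_sub_abs_sub_lt_one (a b : ℝ) :
    |(|(⌊a⌋ - ⌊b⌋ : ℝ)| - |a - b|)| < 1 := by
  refine (abs_abs_sub_abs_le _ _).trans_lt (abs_lt.2 ?_)
  constructor <;> linarith [Int.floor_le a, Int.floor_le b, Int.lt_floor_add_one a,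
    Int.lt_floor_add_one b]

theorem abs_sub_le_of_mem_cellNbhd (hM : 0 < M) (hy : y ∈ cellNbhd M K ⌊M * x⌋) :
    |x - y| ≤ (K + 1) / M := by
  have hM' : (0 : ℝ) < M := by exact_mod_cast hM
  have hfloor := mem_cellNbhd_floor_iff.1 hy
  have hround := (abs_lt.1 (abs_floor_sub_floor_sub_abs_sub_lt_one (M * x) (M * y))).1
  rw [← mul_sub, abs_mul, Nat.abs_cast] at hround
  rw [le_div_iff₀' hM']
  linarith

theorem mem_cellNbhd_iff_abs_sub_le (hM : 0 < M) (hr : 0 ≤ r) (h : 1 / M < |(|x - y| - r)|) :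
    y ∈ cellNbhd M ⌊r * M⌋₊ ⌊M * x⌋ ↔ |x - y| ≤ r := by
  have hM' : (0 : ℝ) < M := by exact_mod_cast hM
  have hround := abs_lt.1 (abs_floor_sub_floor_sub_abs_sub_lt_one (M * x) (M * y))
  rw [← mul_sub, abs_mul, Nat.abs_cast] at hround
  rw [mem_cellNbhd_floor_iff]
  rw [div_lt_iff₀' hM'] at h
  constructor
  · intro hfloor
    by_contra! hlt
    rw [abs_of_pos (sub_pos.2 hlt)] at h
    linarith [Nat.floor_le (mul_nonneg hr hM'.le)]
  · intro hle
    rw [abs_of_nonpos (sub_nonpos.2 hle)] at h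
    have hlt : |⌊M * x⌋ - ⌊M * y⌋| ≤ (⌊r * M⌋₊ : ℤ) := by
      rw [Int.natCast_floor_eq_floor (mul_nonneg hr hM'.le), Int.le_floor]
      push_cast
      linarith
    exact_mod_cast hlt

theorem sum_indicator_cellNbhd_le (W : Finset ℤ) (x : ℝ) :
    ∑ w ∈ W, (cellNbhd M K w).indicator (1 : ℝ → ℝ) x ≤ 2 * K + 1 := by
  classical
  have hsub : W.filter (x ∈ cellNbhd M K ·) ⊆ Finset.Icc (⌊M * x⌋ - K) (⌊M * x⌋ + K) :=
    fun w hw => by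
      have := (Finset.mem_filter.1 hw).2
      simp only [cellNbhd, mem_ofPred_eq, Finset.mem_Icc] at this ⊢
      lia
  have hcard : (W.filter (x ∈ cellNbhd M K ·)).card ≤ 2 * K + 1 :=
    (Finset.card_le_card hsub).trans_eq (by rw [Int.card_Icc]; lia)
  simp only [indicator_apply, Pi.one_apply, Finset.sum_boole]
  exact_mod_cast hcard

theorem sum_unitMeasure_real_cellNbhd_inter_preimage_timesMap_le {L : ℕ} (hM : 0 < M)
    (hL : 2 ≤ L) (W : Finset ℤ) :
    ∑ w ∈ W, unitMeasure.real (cellNbhd M K w ∩ timesMap L ⁻¹' cellNbhd M K w) ≤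
      4 * M * ((2 * K + 1) / M) ^ 2 := by
  set E : Set ℝ := {x | |x - timesMap L x| ≤ (2 * K + 1) / M}
  have hE : MeasurableSet E :=
    measurableSet_le (measurable_id.sub (measurable_timesMap L)).abs measurable_const
  have close (w : ℤ) : cellNbhd M K w ∩ timesMap L ⁻¹' cellNbhd M K w ⊆ cellNbhd M K w ∩ E := by
    rintro x ⟨hx, hLx⟩
    refine ⟨hx, (abs_sub_le_of_mem_cellNbhd (K := 2 * K) hM ?_).trans_eq (by push_cast; rfl)⟩
    simp only [cellNbhd, mem_preimage, mem_ofPred_eq, Finset.mem_Icc] at hx hLx ⊢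
    lia
  calc ∑ w ∈ W, unitMeasure.real (cellNbhd M K w ∩ timesMap L ⁻¹' cellNbhd M K w)
      ≤ ∑ w ∈ W, unitMeasure.real (cellNbhd M K w ∩ E) :=
        Finset.sum_le_sum fun w _ => measureReal_mono (close w)
    _ ≤ (2 * K + 1) * unitMeasure.real E :=
        sum_measureReal_inter_le_mul (measurableSet_cellNbhd M K) hE
          (sum_indicator_cellNbhd_le W)
    _ ≤ (2 * K + 1) * (4 * ((2 * K + 1) / M)) := by
        gcongr
        exact unitMeasure_real_abs_sub_timesMap_le hL (by positivity)
    _ = 4 * M * ((2 * K + 1) / M) ^ 2 := by field_simp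

end Cell

section Comparison

variable {b m n K M : ℕ} {r p : ℝ}

theorem sum_clusterError_cellNbhd_le (hb : 2 ≤ b) (hM : 0 < M) (hp : p = (2 * K + 1) / M)
    (m : ℕ) :
    ∑ w ∈ Finset.Ico (K : ℤ) (M - K), clusterError unitMeasure (timesMap b) (cellNbhd M K w) m ≤
      M * (5 * m * p ^ 2) := by
  have marginal : ∑ w ∈ Finset.Ico (K : ℤ) (M - K), m * unitMeasure.real (cellNbhd M K w) ^ 2 ≤
      M * (m * p ^ 2) := by
    rw [Finset.sum_congr rfl fun w hw => by rw [unitMeasure_real_cellNbhd hw, ← hp],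
      Finset.sum_const, nsmul_eq_mul, Int.card_Ico]
    gcongr
    lia
  have joint : ∑ g ∈ Finset.range m, ∑ w ∈ Finset.Ico (K : ℤ) (M - K),
      unitMeasure.real (cellNbhd M K w ∩ (timesMap b)^[g + 1] ⁻¹' cellNbhd M K w) ≤
      m * (4 * M * p ^ 2) := by
    rw [← nsmul_eq_mul]
    refine (Finset.sum_le_card_nsmul _ _ _ fun g _ => ?_).trans_eq (by rw [Finset.card_range])
    rw [iterate_timesMap _ (Nat.succ_ne_zero _), hp]
    exact sum_unitMeasure_real_cellNbhd_inter_preimage_timesMap_le hM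
      (hb.trans (Nat.le_self_pow g.succ_ne_zero b)) _
  calc ∑ w ∈ Finset.Ico (K : ℤ) (M - K), clusterError unitMeasure (timesMap b) (cellNbhd M K w) m
      ≤ M * (m * p ^ 2) + m * (4 * M * p ^ 2) := by
        simp only [clusterError, Finset.sum_add_distrib]
        rw [Finset.sum_comm]
        exact add_le_add marginal joint
    _ = M * (5 * m * p ^ 2) := by ring

theorem abs_unitMeasure_real_visitCount_cellNbhd_sub_le (hb : 0 < b) (hM : M = b ^ (m + 1))
    {w : ℤ} (hw : w ∈ Finset.Ico (K : ℤ) (M - K)) (n k : ℕ) :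
    |unitMeasure.real {x | visitCount (timesMap b) (cellNbhd M K w) n x = k} -
        binomialWeight ((2 * K + 1) / M) n k| ≤
      n * (2 * clusterError unitMeasure (timesMap b) (cellNbhd M K w) m) := by
  rw [← unitMeasure_real_cellNbhd hw]
  refine abs_measureReal_visitCount_sub_binomialWeight_le (measurePreserving_timesMap hb)
    (measurableSet_cellNbhd M K w) (fun C hC => ?_) n k
  rw [iterate_timesMap _ (Nat.succ_ne_zero _), ← hM]
  exact unitMeasure_real_floor_mem_inter (hM ▸ Nat.pow_pos hb) _ hC

theorem sum_abs_unitMeasure_real_visitCount_cellNbhd_sub_le (hb : 2 ≤ b)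
    (hM : M = b ^ (m + 1)) (hp : p = (2 * K + 1) / M) (hp1 : p ≤ 1) (n k : ℕ) :
    ∑ w ∈ Finset.Ico 0 (M : ℤ),
      |unitMeasure.real {x | visitCount (timesMap b) (cellNbhd M K w) n x = k} -
        binomialWeight p n k| ≤ M * (10 * n * m * p ^ 2 + p) := by
  have hM0 : 0 < M := hM ▸ Nat.pow_pos (by lia)
  have hM0' : (0 : ℝ) < M := by exact_mod_cast hM0
  have hKM : 2 * K + 1 ≤ M := by
    rw [hp, div_le_one hM0'] at hp1
    exact_mod_cast hp1
  have hweight := binomialWeight_mem_Icc (p := p) ⟨hp ▸ by positivity, hp1⟩ n k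
  set F : ℤ → ℝ := fun w =>
    |unitMeasure.real {x | visitCount (timesMap b) (cellNbhd M K w) n x = k} -
      binomialWeight p n k|
  set I : Finset ℤ := Finset.Ico (K : ℤ) (M - K)
  have hI : I ⊆ Finset.Ico 0 (M : ℤ) := Finset.Ico_subset_Ico (by lia) (by lia)
  have inner : ∑ w ∈ I, F w ≤ n * (2 * (M * (5 * m * p ^ 2))) := by
    refine (Finset.sum_le_sum fun w hw => hp ▸
      abs_unitMeasure_real_visitCount_cellNbhd_sub_le (by lia) hM hw n k).trans ?_
    rw [← Finset.mul_sum, ← Finset.mul_sum]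
    gcongr
    exact sum_clusterError_cellNbhd_le hb hM0 hp m
  have outer : ∑ w ∈ Finset.Ico 0 (M : ℤ) \ I, F w ≤ 2 * K := by
    refine (Finset.sum_le_card_nsmul _ _ (1 : ℝ) fun w _ => ?_).trans ?_
    · exact abs_sub_le_of_nonneg_of_le measureReal_nonneg measureReal_le_one hweight.1 hweight.2
    · rw [Finset.card_sdiff_of_subset hI, Int.card_Ico, Int.card_Ico, nsmul_one]
      norm_cast
      lia
  calc ∑ w ∈ Finset.Ico 0 (M : ℤ), F w
      ≤ 2 * K + n * (2 * (M * (5 * m * p ^ 2))) := by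
        rw [← Finset.sum_sdiff hI]
        exact add_le_add outer inner
    _ ≤ M * (10 * n * m * p ^ 2 + p) := by
        rw [mul_add, hp, mul_div_cancel₀ _ hM0'.ne']
        linarith

theorem abs_unitMeasure_real_visitCount_cellNbhd_floor_sub_le (hb : 2 ≤ b)
    (hM : M = b ^ (m + 1)) (hp : p = (2 * K + 1) / M) (hp1 : p ≤ 1) (n k : ℕ) :
    |unitMeasure.real
        {x | visitCount (timesMap b) (cellNbhd M K ⌊M * x⌋) n ((timesMap b)^[m + 1] x) = k} -
      binomialWeight p n k| ≤ 10 * n * m * p ^ 2 + p := by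
  have hM0 : 0 < M := hM ▸ Nat.pow_pos (by lia)
  have hM0' : (0 : ℝ) < M := by exact_mod_cast hM0
  set Q : ℤ → Set ℝ := fun w => {y | visitCount (timesMap b) (cellNbhd M K w) n y = k}
  have hQ (w : ℤ) : MeasurableSet (Q w) :=
    measurable_visitCount (measurable_timesMap b) (measurableSet_cellNbhd M K w) n
      (measurableSet_singleton k)
  have average : unitMeasure.real {x | (timesMap b)^[m + 1] x ∈ Q ⌊M * x⌋} -
      binomialWeight p n k =
      (∑ w ∈ Finset.Ico 0 (M : ℤ), (unitMeasure.real (Q w) - binomialWeight p n k)) / M := by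
    rw [iterate_timesMap _ (Nat.succ_ne_zero _), ← hM, unitMeasure_real_timesMap_mem_floor hM0 hQ,
      Finset.sum_sub_distrib, sub_div, Finset.sum_const, Int.card_Ico, sub_zero,
      Int.toNat_natCast, nsmul_eq_mul, mul_div_cancel_left₀ _ hM0'.ne']
  change |unitMeasure.real {x | (timesMap b)^[m + 1] x ∈ Q ⌊M * x⌋} - binomialWeight p n k| ≤ _
  rw [average, abs_div, Nat.abs_cast, div_le_iff₀' hM0']
  exact (Finset.abs_sum_le_sum_abs _ _).trans
    (sum_abs_unitMeasure_real_visitCount_cellNbhd_sub_le hb hM hp hp1 n k)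

theorem recurrenceCount_eq_visitCount_cellNbhd {f : ℝ → ℝ} {x : ℝ} (hM : 0 < M) (hr : 0 ≤ r)
    (hfar : ∀ j ∈ Finset.Ico 1 (m + 1) ∪ Finset.Ico (n + 1) (n + m + 1),
      r + 1 / M < |x - f^[j] x|)
    (hcritical : ∀ j ∈ Finset.Icc 1 n, 1 / M < |(|x - f^[j] x| - r)|) :
    recurrenceCount f n r x =
      visitCount f (cellNbhd M ⌊r * M⌋₊ ⌊M * x⌋) n (f^[m + 1] x) := by
  have hM' : (0 : ℝ) < M := by exact_mod_cast hM
  have near_of_mem {j : ℕ} (hj : f^[j] x ∈ cellNbhd M ⌊r * M⌋₊ ⌊M * x⌋) :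
      |x - f^[j] x| ≤ r + 1 / M := by
    refine (abs_sub_le_of_mem_cellNbhd hM hj).trans ?_
    rw [add_div, add_le_add_iff_right, div_le_iff₀ hM']
    exact Nat.floor_le (mul_nonneg hr hM'.le)
  have mem_iff {j : ℕ} (hj : j ∈ Finset.Icc 1 n) :=
    mem_cellNbhd_iff_abs_sub_le hM hr (hcritical j hj)
  rw [recurrenceCount, visitCount_iterate]
  congr 1
  ext j
  simp only [Finset.mem_filter, Real.dist_eq]
  simp only [Finset.mem_union, Finset.mem_Ico] at hfar
  constructor
  · rintro ⟨hj, hjr⟩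
    refine ⟨?_, (mem_iff hj).2 hjr⟩
    rw [Finset.mem_Icc] at hj
    by_contra hlt
    rw [Finset.mem_Ico] at hlt
    linarith [hfar j (by lia), one_div_pos.2 hM']
  · rintro ⟨hj, hjmem⟩
    have hjn : j ∈ Finset.Icc 1 n := by
      rw [Finset.mem_Ico] at hj
      by_contra hlt
      rw [Finset.mem_Icc] at hlt
      linarith [hfar j (by lia), near_of_mem hjmem]
    exact ⟨hjn, (mem_iff hjn).1 hjmem⟩

theorem abs_unitMeasure_real_recurrenceCount_sub_le (hb : 2 ≤ b) (hM : 0 < M) (hr : 0 ≤ r)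
    (m n k : ℕ) :
    |unitMeasure.real {x | recurrenceCount (timesMap b) n r x = k} -
      unitMeasure.real {x | visitCount (timesMap b) (cellNbhd M ⌊r * M⌋₊ ⌊M * x⌋) n
        ((timesMap b)^[m + 1] x) = k}| ≤ 8 * m * (r + 1 / M) + 8 * n / M := by
  have two_le_pow {j : ℕ} (hj : j ≠ 0) : 2 ≤ b ^ j := hb.trans (Nat.le_self_pow hj b)
  set J : Finset ℕ := Finset.Ico 1 (m + 1) ∪ Finset.Ico (n + 1) (n + m + 1)
  set near : Set ℝ := ⋃ j ∈ J, {x | |x - (timesMap b)^[j] x| ≤ r + 1 / M}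
  set critical : Set ℝ :=
    ⋃ j ∈ Finset.Icc 1 n, {x | |(|x - (timesMap b)^[j] x| - r)| ≤ 1 / M}
  have hnear : unitMeasure.real near ≤ (2 * m : ℕ) * (4 * (r + 1 / M)) := by
    refine (measureReal_biUnion_finset_le_card_mul fun j hj => ?_).trans
      (mul_le_mul_of_nonneg_right (?_ : (J.card : ℝ) ≤ (2 * m : ℕ)) (by positivity))
    · have hj0 : j ≠ 0 := by
        simp only [J, Finset.mem_union, Finset.mem_Ico] at hj
        lia
      rw [iterate_timesMap b hj0]
      exact unitMeasure_real_abs_sub_timesMap_le (two_le_pow hj0) (by positivity)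
    · refine Nat.cast_le.2 ((Finset.card_union_le _ _).trans ?_)
      simp only [Nat.card_Ico]
      lia
  have hcritical : unitMeasure.real critical ≤ n * (8 * (1 / M)) := by
    refine (measureReal_biUnion_finset_le_card_mul fun j hj => ?_).trans_eq
      (by rw [Nat.card_Icc, Nat.add_sub_cancel])
    have hj0 : j ≠ 0 := Nat.one_le_iff_ne_zero.1 (Finset.mem_Icc.1 hj).1
    rw [iterate_timesMap b hj0]
    exact unitMeasure_real_abs_abs_sub_timesMap_sub_le (two_le_pow hj0) (by positivity) r
  refine (abs_measureReal_sub_le_of_forall_notMem_iff (e := near ∪ critical) fun x hx => ?_).trans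
    ((measureReal_union_le _ _).trans ((add_le_add hnear hcritical).trans_eq ?_))
  · simp only [near, critical, mem_union, mem_iUnion, mem_ofPred_eq, not_or, not_exists,
      not_le] at hx
    simp only [mem_ofPred_eq, recurrenceCount_eq_visitCount_cellNbhd hM hr hx.1 hx.2]
  · push_cast
    ring

theorem abs_unitMeasure_real_recurrenceCount_sub_binomialWeight_le (hb : 2 ≤ b)
    (hM : M = b ^ (m + 1)) (hr : 0 ≤ r) (hp : p = (2 * ⌊r * M⌋₊ + 1) / M) (hp1 : p ≤ 1)
    (n k : ℕ) :
    |unitMeasure.real {x | recurrenceCount (timesMap b) n r x = k} - binomialWeight p n k| ≤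
      8 * m * (r + 1 / M) + 8 * n / M + (10 * n * m * p ^ 2 + p) :=
  (abs_sub_le _ _ _).trans (add_le_add
    (abs_unitMeasure_real_recurrenceCount_sub_le hb (hM ▸ Nat.pow_pos (by lia)) hr m n k)
    (abs_unitMeasure_real_visitCount_cellNbhd_floor_sub_le hb hM hp hp1 n k))

end Comparison

section Limit

variable {b : ℕ} {r : ℕ → ℝ} {τ : ℝ}

theorem tendsto_natSqrt_atTop : Tendsto Nat.sqrt atTop atTop :=
  tendsto_atTop_atTop.2 fun c => ⟨c * c, fun _ hn => Nat.le_sqrt.2 hn⟩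

theorem tendsto_natSqrt_div : Tendsto (fun n : ℕ => (Nat.sqrt n : ℝ) / n) atTop (𝓝 0) := by
  refine squeeze_zero (fun n => by positivity) (fun n => ?_)
    (tendsto_inv_atTop_nhds_zero_nat.comp tendsto_natSqrt_atTop)
  rcases Nat.eq_zero_or_pos (Nat.sqrt n) with h | h
  · simp [h]
  · have hsqrt : (0 : ℝ) < Nat.sqrt n := by exact_mod_cast h
    have hsq : (Nat.sqrt n : ℝ) * Nat.sqrt n ≤ n := by exact_mod_cast Nat.sqrt_le n
    rw [comp_apply, ← one_div, div_le_div_iff₀ (by nlinarith) hsqrt]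
    linarith

theorem tendsto_div_pow_natSqrt_succ (hb : 1 < b) :
    Tendsto (fun n : ℕ => (n : ℝ) / (b ^ (Nat.sqrt n + 1) : ℕ)) atTop (𝓝 0) := by
  have h := (tendsto_pow_const_div_const_pow_of_one_lt 2 (r := (b : ℝ))
    (by exact_mod_cast hb)).comp ((tendsto_add_atTop_nat 1).comp tendsto_natSqrt_atTop)
  refine squeeze_zero (fun n => by positivity) (fun n => ?_) h
  have hn : n ≤ (Nat.sqrt n + 1) ^ 2 := sq (Nat.sqrt n + 1) ▸ (Nat.lt_succ_sqrt n).le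
  simp only [comp_apply, Nat.cast_pow]
  gcongr
  exact_mod_cast hn

theorem abs_two_mul_floor_add_one_div_sub_le {r : ℝ} {M : ℕ} (hM : 0 < M) (hr : 0 ≤ r) :
    |(2 * ⌊r * M⌋₊ + 1) / M - 2 * r| ≤ 1 / M := by
  have hM' : (0 : ℝ) < M := by exact_mod_cast hM
  have hle := Nat.floor_le (mul_nonneg hr hM'.le)
  have hlt := Nat.lt_floor_add_one (r * M)
  rw [show (2 * ⌊r * M⌋₊ + 1) / M - 2 * r = (2 * ⌊r * M⌋₊ + 1 - 2 * (r * M)) / M by field_simp,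
    abs_div, Nat.abs_cast]
  gcongr
  rw [abs_le]
  constructor <;> linarith

theorem tendsto_mul_two_mul_floor_add_one_div {M : ℕ → ℕ} (hM : ∀ n, 0 < M n)
    (hnM : Tendsto (fun n : ℕ => (n : ℝ) / M n) atTop (𝓝 0)) (hr : ∀ n, 0 ≤ r n)
    (hτ : Tendsto (fun n : ℕ => n * r n) atTop (𝓝 (τ / 2))) :
    Tendsto (fun n : ℕ => n * ((2 * ⌊r n * M n⌋₊ + 1) / M n : ℝ)) atTop (𝓝 τ) := by
  refine tendsto_of_tendsto_of_dist (mul_div_cancel₀ τ two_ne_zero ▸ hτ.const_mul 2)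
    (squeeze_zero (fun n => dist_nonneg) (fun n => ?_) hnM)
  rw [dist_comm, Real.dist_eq, show n * ((2 * ⌊r n * M n⌋₊ + 1) / M n : ℝ) - 2 * (n * r n) =
    n * ((2 * ⌊r n * M n⌋₊ + 1) / M n - 2 * r n) by ring, abs_mul, Nat.abs_cast,
    ← mul_one_div (n : ℝ)]
  gcongr
  exact abs_two_mul_floor_add_one_div_sub_le (hM n) (hr n)

theorem tendsto_zero_of_tendsto_natCast_mul {u : ℕ → ℝ} {c : ℝ}
    (h : Tendsto (fun n : ℕ => n * u n) atTop (𝓝 c)) : Tendsto u atTop (𝓝 0) := by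
  refine (h.div_atTop tendsto_natCast_atTop_atTop).congr' ?_
  filter_upwards [eventually_ne_atTop 0] with n hn
  exact mul_div_cancel_left₀ _ (Nat.cast_ne_zero.2 hn)

theorem mainTheorem5_general (hb : 2 ≤ b) (hr : ∀ n, 0 ≤ r n)
    (hτ : Tendsto (fun n : ℕ => n * r n) atTop (𝓝 (τ / 2))) (k : ℕ) :
    Tendsto (fun n => unitMeasure.real {x | recurrenceCount (timesMap b) n (r n) x = k}) atTop
      (𝓝 (τ ^ k / k.factorial * Real.exp (-τ))) := by
  set M : ℕ → ℕ := fun n => b ^ (Nat.sqrt n + 1)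
  set p : ℕ → ℝ := fun n => (2 * ⌊r n * M n⌋₊ + 1) / M n
  have hnM : Tendsto (fun n : ℕ => (n : ℝ) / M n) atTop (𝓝 0) := tendsto_div_pow_natSqrt_succ hb
  have hnp : Tendsto (fun n : ℕ => n * p n) atTop (𝓝 τ) :=
    tendsto_mul_two_mul_floor_add_one_div (fun n => Nat.pow_pos (by lia)) hnM hr hτ
  have hp : Tendsto p atTop (𝓝 0) := tendsto_zero_of_tendsto_natCast_mul hnp
  have poisson : Tendsto (fun n => binomialWeight (p n) n k) atTop
      (𝓝 (τ ^ k / k.factorial * Real.exp (-τ))) := by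
    rw [mul_comm, ← mul_div_assoc]
    exact ProbabilityTheory.tendsto_choose_mul_pow_of_tendsto_mul_atTop k hnp
  have error : Tendsto (fun n : ℕ => Nat.sqrt n / n *
      (8 * (n * r n + n / M n) + 10 * (n * p n) ^ 2) + 8 * (n / M n) + p n) atTop (𝓝 0) := by
    simpa using ((tendsto_natSqrt_div.mul (((hτ.add hnM).const_mul 8).add
      ((hnp.pow 2).const_mul 10))).add (hnM.const_mul 8)).add hp
  refine tendsto_of_tendsto_of_dist poisson
    (squeeze_zero' (.of_forall fun _ => dist_nonneg) ?_ error)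
  filter_upwards [hp.eventually_le_const zero_lt_one, eventually_ne_atTop 0] with n hpn hn
  rw [dist_comm, Real.dist_eq]
  refine (abs_unitMeasure_real_recurrenceCount_sub_binomialWeight_le hb rfl (hr n) rfl hpn
    n k).trans_eq ?_
  change 8 * (Nat.sqrt n : ℝ) * (r n + 1 / M n) + 8 * n / M n +
    (10 * n * Nat.sqrt n * p n ^ 2 + p n) = _
  field_simp
  ring

end Limit

theorem coe_iterate_doublingMap (j : ℕ) (x : unitInterval) :
    (doublingMap^[j] x : ℝ) = (timesMap 2)^[j] x :=
  Semiconj.iterate_right (f := ((↑) : unitInterval → ℝ)) (fun _ => rfl) j x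

theorem volume_real_recurrenceCount_doublingMap (n : ℕ) (r : ℝ) (k : ℕ) :
    (volume : Measure unitInterval).real {x | recurrenceCount doublingMap n r x = k} =
      unitMeasure.real {x | recurrenceCount (timesMap 2) n r x = k} := by
  have hcoe : {x : unitInterval | recurrenceCount doublingMap n r x = k} =
      (↑) ⁻¹' {x : ℝ | recurrenceCount (timesMap 2) n r x = k} := by
    ext x
    simp only [recurrenceCount, Subtype.dist_eq, coe_iterate_doublingMap, mem_preimage,
      mem_ofPred_eq]
  rw [hcoe, measureReal_def, unitInterval.measurePreserving_coe.measure_preimage_emb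
    (MeasurableEmbedding.subtype_coe measurableSet_Icc), unitMeasure,
    Measure.restrict_congr_set Ico_ae_eq_Icc, measureReal_def]

theorem mainTheorem5 (τ : ℝ) (hτ : 0 < τ) (k : ℕ) :
    Filter.Tendsto
      (fun n : ℕ =>
        (MeasureTheory.volume : MeasureTheory.Measure unitInterval).real
          {x : unitInterval | recurrenceCount doublingMap n (τ / (2 * (n : ℝ))) x = k})
      Filter.atTop
      (nhds (τ ^ k / (Nat.factorial k : ℝ) * Real.exp (-τ))) := by
  simp only [volume_real_recurrenceCount_doublingMap]
  refine mainTheorem5_general le_rfl (fun n => by positivity) (tendsto_const_nhds.congr' ?_) k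
  filter_upwards [eventually_ne_atTop 0] with n hn
  field_simp
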